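/- Let $\mathcal{B}_n$ be the set of signed permutations of $[n]=\{1,\dots,n\}$, i.e. of permutations $\pi$ of $\{-n,\dots,-1,1,\dots,n\}$ with $\pi(-i)=-\pi(i)$; write $\pi_i=\pi(i)$ and $\pi_0=0$. Let $$\mathrm{Des}_B(\pi)=\{i : 0\le i\le n-1,\ \pi_i>\pi_{i+1}\},\qquad \mathrm{neg}(\pi)=|\{i\in[n]:\pi_i<0\}|,\qquad \mathrm{fmaj}(\pi)=\sum_{i\in \mathrm{Des}_B(\pi)}2i+\mathrm{neg}(\pi).$$ For integers $n\ge 0$ and $k$ let $\mathcal{B}^{>}_{n,k}$ be the set of pairs $(\pi,S)$ with $\pi\in\mathcal{B}_n$, $S\subseteq \mathrm{Des}_B(\pi)$ and $|S|=k$ (descent-starred signed permutations), and put $$\mathrm{fmaj}((\pi,S))=\mathrm{fmaj}(\pi)-\sum_{j\in S}\bigl(2\,|\mathrm{Des}_B(\pi)\cap\{j,\dots,n-1\}|-1\bigr),\qquad B^{\mathrm{fmaj}}_{n,k}(q)=\sum_{(\pi,S)\in\mathcal{B}^{>}_{n,k}}q^{\mathrm{fmaj}((\pi,S))}.$$ Let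 $[m]_q=(q^m-1)/(q-1)$ for $m\in\mathbb{Z}$, so that $[m]_q=1+q+\cdots+q^{m-1}$ for $m\ge 0$. **Proposition 2.7.** Each $B^{\mathrm{fmaj}}_{n,k}(q)$ is a polynomial in $q$ with integer coefficients. For all integers $n\ge1$ and $k$, $$B^{\mathrm{fmaj}}_{n,k}(q)=[2n-2k]_q\,B^{\mathrm{fmaj}}_{n-1,k}(q)+[2n-2k+1]_q\,B^{\mathrm{fmaj}}_{n-1,k-1}(q),$$ where, for every $n\ge 0$, $B^{\mathrm{fmaj}}_{n,k}(q)=1$ if $k=n$ and $B^{\mathrm{fmaj}}_{n,k}(q)=0$ if $k<0$ or $k>n$. -/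

import Mathlib

namespace FlagMajor

open LaurentPolynomial

/-- The set `[±n] = {-n, …, -1, 1, …, n}`. -/
noncomputable def pmSet (n : ℕ) : Finset ℤ := (Finset.Icc (-(n : ℤ)) (n : ℤ)).erase 0

/-- The signed permutations of `[n]`: the permutations `π` of `[±n]` with `π(-i) = -π(i)`. -/
noncomputable def signedPerms (n : ℕ) : Finset (Equiv.Perm (pmSet n)) :=
  Finset.univ.filter fun π => ∀ i j : pmSet n, (j : ℤ) = -(i : ℤ) → (π j : ℤ) = -(π i : ℤ)

/-- The letter `π_i = π(i)` for `i ∈ [±n]`, with the convention `π_0 = 0`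
(the value `0` at all other integers is never used). -/
noncomputable def letter {n : ℕ} (π : Equiv.Perm (pmSet n)) (i : ℤ) : ℤ :=
  if h : i ∈ pmSet n then (π ⟨i, h⟩ : ℤ) else 0

/-- The type B descent set `{i ∈ {0, …, n - 1} : π_i > π_{i+1}}`. -/
noncomputable def desB {n : ℕ} (π : Equiv.Perm (pmSet n)) : Finset ℕ :=
  (Finset.range n).filter fun i : ℕ => letter π ((i : ℤ) + 1) < letter π (i : ℤ)

/-- The number of `i ∈ {1, …, n}` with `π_i < 0`. -/
noncomputable def neg {n : ℕ} (π : Equiv.Perm (pmSet n)) : ℕ :=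
  ((Finset.Icc 1 n).filter fun i : ℕ => letter π (i : ℤ) < 0).card

/-- The flag-major index of `π`. -/
noncomputable def fmaj {n : ℕ} (π : Equiv.Perm (pmSet n)) : ℕ :=
  (∑ i ∈ desB π, 2 * i) + neg π

/-- The descent-starred signed permutations `(π, S)` of `[n]` with `k` stars:
`S` is a set of type B descents of `π` and `|S| = k`. -/
noncomputable def starred (n : ℕ) (k : ℤ) : Finset (Equiv.Perm (pmSet n) × Finset ℕ) :=
  (signedPerms n ×ˢ (Finset.range n).powerset).filter fun x =>
    x.2 ⊆ desB x.1 ∧ (x.2.card : ℤ) = k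

/-- The flag-major index of a descent-starred signed permutation:
`fmaj(π) - ∑_{j ∈ S} (2 |Des_B(π) ∩ {j, …, n - 1}| - 1)`, an integer. -/
noncomputable def fmajStar {n : ℕ} (x : Equiv.Perm (pmSet n) × Finset ℕ) : ℤ :=
  (fmaj x.1 : ℤ) - ∑ j ∈ x.2, (2 * ((desB x.1 ∩ Finset.Ico j n).card : ℤ) - 1)

/-- The generating function `∑ q ^ fmaj((π, S))` over the descent-starred signed permutations of
`[n]` with `k` stars, where `q` is the variable `T 1` of the ring of Laurent polynomials. -/
noncomputable def Bfmaj (n : ℕ) (k : ℤ) : ℤ[T;T⁻¹] :=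
  ∑ x ∈ starred n k, T (fmajStar x)

/-- The `q`-integer `[m]_q = (q ^ m - 1) / (q - 1)`, that is `1 + q + ⋯ + q ^ (m - 1)` for `0 ≤ m`
and `-(q ^ m + ⋯ + q ^ (-1))` for `m < 0`. -/
noncomputable def qInt (m : ℤ) : ℤ[T;T⁻¹] :=
  ∑ i ∈ Finset.Ico 0 m, T i - ∑ i ∈ Finset.Ico m 0, T i

end FlagMajor

namespace FlagMajor

open LaurentPolynomial

/-! For fixed `π` with `d` descents, a star on the `r`-th descent from the right has weight
`q^{-(2r-1)}`. Summing over `S` therefore gives `q^{fmaj π}` times the elementary symmetric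
polynomial `e_k(q⁻¹, q⁻³, …, q^{-(2d-1)})`, which depends on `π` only through `d` (`Bfmaj_natCast`).
Inserting `±(n+1)` into a signed word of `[n]` raises `fmaj` by each of `0, …, 2n+1` exactly once.
Increments `0, …, 2d` keep `d` descents and `2d+1, …, 2n+1` create one more
(`sum_insertLetter_des_fmaj`). Multiplying by `q - 1` telescopes these sums. The ratio of
consecutive `e_k` (`starWeight_succ_right`) then turns the result into a combination of `e_k` and
`e_{k+1}` whose coefficients no longer involve `d` (`starWeight_insertion_identity`), and summing
over words gives the recurrence. -/

/-! ### Summation over the star sets -/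

/-- The elementary symmetric polynomial of degree `k` in `q⁻¹, q⁻³, …, q^{-(2d-1)}`. -/
noncomputable def starWeight : ℕ → ℕ → ℤ[T;T⁻¹]
  | _, 0 => 1
  | 0, _ + 1 => 0
  | d + 1, k + 1 => starWeight d (k + 1) + T (-(2 * (d : ℤ) + 1)) * starWeight d k

@[simp] lemma starWeight_zero_right (d : ℕ) : starWeight d 0 = 1 := by
  cases d <;> rfl

@[simp] lemma starWeight_zero_succ (k : ℕ) : starWeight 0 (k + 1) = 0 := rfl

lemma starWeight_succ_succ (d k : ℕ) : starWeight (d + 1) (k + 1) =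
    starWeight d (k + 1) + T (-(2 * (d : ℤ) + 1)) * starWeight d k := rfl

/-- The recurrence in `k` coming from `e_k = q^{-k²} [d choose k]_{q⁻²}`. -/
lemma starWeight_succ_right (d k : ℕ) :
    (1 - T (-(2 * (k : ℤ) + 2))) * starWeight d (k + 1) =
      (T (-(2 * (k : ℤ) + 1)) - T (-(2 * (d : ℤ) + 1))) * starWeight d k := by
  induction d generalizing k with
  | zero =>
    cases k with
    | zero => simp
    | succ k => simp
  | succ d ih =>
    cases k with
    | zero =>
      have h := ih 0
      rw [starWeight_succ_succ, mul_add, h]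
      simp only [starWeight_zero_right, mul_one, sub_mul, one_mul, ← T_add]
      push_cast
      ring_nf
    | succ k =>
      have h1 := ih (k + 1)
      have h0 := ih k
      rw [starWeight_succ_succ, starWeight_succ_succ, mul_add, h1]
      generalize starWeight d (k + 1) = a at *
      generalize starWeight d k = b at *
      -- Once the `q^{-(2d+1)} a` terms cancel, the claim left over is `q^{-(2d+3)}` times the
      -- induction hypothesis at `k`.
      have e : (T (-(2 * (d : ℤ) + 3)) : ℤ[T;T⁻¹]) * ((1 - T (-(2 * (k : ℤ) + 2))) * a) =
        T (-(2 * (d : ℤ) + 3)) * ((T (-(2 * (k : ℤ) + 1)) - T (-(2 * (d : ℤ) + 1))) * b) := by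
        rw [h0]
      simp only [← mul_assoc, mul_sub, sub_mul, mul_add, ← T_add, one_mul] at e ⊢
      push_cast
      ring_nf at e ⊢
      linear_combination e

/-- A new minimum `a` does not change the counts at larger elements, while its own count is the full
cardinality `d + 1`. Its weight `q^{-(2d+1)}` is thus the next variable of `starWeight`. -/
lemma sum_powersetCard_starWeight (D : Finset ℕ) (k : ℕ) :
    ∑ S ∈ D.powersetCard k,
        ∏ j ∈ S, (T (-(2 * ((D.filter (j ≤ ·)).card : ℤ) - 1)) : ℤ[T;T⁻¹]) =
      starWeight D.card k := by
  induction D using Finset.induction_on_min generalizing k with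
  | empty =>
    cases k with
    | zero => simp
    | succ k => rw [Finset.powersetCard_eq_empty.2 (by simp)]; simp
  | insert a D ha ih =>
    have haD : a ∉ D := fun h => lt_irrefl _ (ha a h)
    cases k with
    | zero => simp
    | succ k =>
      have hcard : ∀ S ⊆ D,
          ∏ j ∈ S, (T (-(2 * (((insert a D).filter (j ≤ ·)).card : ℤ) - 1)) : ℤ[T;T⁻¹]) =
          ∏ j ∈ S, T (-(2 * ((D.filter (j ≤ ·)).card : ℤ) - 1)) := by
        intro S hS
        refine Finset.prod_congr rfl fun j hj => ?_
        rw [Finset.filter_insert, if_neg (not_le.2 (ha j (hS hj)))]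
      rw [Finset.powersetCard_succ_insert haD, Finset.sum_union, Finset.sum_image,
        Finset.card_insert_of_notMem haD, starWeight_succ_succ, ← ih, ← ih, Finset.mul_sum]
      · congr 1
        · exact Finset.sum_congr rfl fun S hS => hcard S (Finset.mem_powersetCard.1 hS).1
        · refine Finset.sum_congr rfl fun S hS => ?_
          have hS' := (Finset.mem_powersetCard.1 hS).1
          rw [Finset.prod_insert fun h => haD (hS' h), hcard S hS']
          congr 2
          rw [Finset.filter_true_of_mem, Finset.card_insert_of_notMem haD]
          · push_cast; ring
          · intro x hx
            rcases Finset.mem_insert.1 hx with rfl | hx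
            · exact le_rfl
            · exact (ha x hx).le
      · intro S hS S' hS' h
        have hS := (Finset.mem_powersetCard.1 hS).1
        have hS' := (Finset.mem_powersetCard.1 hS').1
        rw [← Finset.erase_insert fun h => haD (hS h), h,
          Finset.erase_insert fun h => haD (hS' h)]
      · rw [Finset.disjoint_left]
        intro S hS hS'
        obtain ⟨U, -, rfl⟩ := Finset.mem_image.1 hS'
        exact haD ((Finset.mem_powersetCard.1 hS).1 (Finset.mem_insert_self a U))

lemma T_sum {ι : Type*} (s : Finset ι) (f : ι → ℤ) :
    (T (∑ i ∈ s, f i) : ℤ[T;T⁻¹]) = ∏ i ∈ s, T (f i) := by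
  classical
  induction s using Finset.induction_on with
  | empty => simp
  | insert a s ha ih => rw [Finset.sum_insert ha, Finset.prod_insert ha, T_add, ih]

lemma desB_subset_range {n : ℕ} (π : Equiv.Perm (pmSet n)) : desB π ⊆ Finset.range n :=
  Finset.filter_subset _ _

lemma Bfmaj_natCast (n k : ℕ) :
    Bfmaj n k = ∑ π ∈ signedPerms n, T (fmaj π) * starWeight (desB π).card k := by
  have hst : starred n k =
      (signedPerms n).biUnion fun π => ((desB π).powersetCard k).image (Prod.mk π) := by
    ext ⟨π, S⟩
    simp only [starred, Finset.mem_filter, Finset.mem_product, Finset.mem_powerset,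
      Finset.mem_biUnion, Finset.mem_image, Finset.mem_powersetCard, Prod.mk.injEq, Nat.cast_inj]
    constructor
    · rintro ⟨⟨h1, -⟩, h2, h3⟩
      exact ⟨π, h1, S, ⟨h2, h3⟩, rfl, rfl⟩
    · rintro ⟨π, h1, S, ⟨h2, h3⟩, rfl, rfl⟩
      exact ⟨⟨h1, h2.trans (desB_subset_range _)⟩, h2, h3⟩
  rw [Bfmaj, hst, Finset.sum_biUnion]
  · refine Finset.sum_congr rfl fun π _ => ?_
    rw [Finset.sum_image fun _ _ _ _ h => (Prod.mk.inj h).2, ← sum_powersetCard_starWeight,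
      Finset.mul_sum]
    refine Finset.sum_congr rfl fun S _ => ?_
    have hD : ∀ j, desB π ∩ Finset.Ico j n = (desB π).filter (j ≤ ·) := by
      intro j
      ext i
      simp only [Finset.mem_inter, Finset.mem_Ico, Finset.mem_filter]
      refine ⟨fun h => ⟨h.1, h.2.1⟩, fun h => ⟨h.1, h.2, ?_⟩⟩
      exact Finset.mem_range.1 (desB_subset_range π h.1)
    rw [fmajStar, sub_eq_add_neg, T_add, ← Finset.sum_neg_distrib, T_sum]
    simp only [hD]
  · intro π _ π' _ hne
    rw [Function.onFun, Finset.disjoint_left]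
    rintro x hx hx'
    obtain ⟨_, -, rfl⟩ := Finset.mem_image.1 hx
    obtain ⟨_, -, h⟩ := Finset.mem_image.1 hx'
    exact hne (Prod.mk.inj h).1.symm

lemma Bfmaj_eq_zero {n : ℕ} {k : ℤ} (hk : k < 0 ∨ (n : ℤ) < k) : Bfmaj n k = 0 := by
  refine Finset.sum_eq_zero fun x hx => ?_
  simp only [starred, Finset.mem_filter, Finset.mem_product, Finset.mem_powerset] at hx
  have := Finset.card_le_card hx.1.2
  rw [Finset.card_range] at this
  omega

/-! ### Ranking of descents and ascents -/

/-- Descents contribute according to the number of later descents, ascents according to the number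
of earlier ascents. -/
lemma sum_range_ite_tail {M : Type*} [AddCommMonoid M] (P : ℕ → Prop) [DecidablePred P]
    (n : ℕ) (f g : ℕ → M) :
    ∑ i ∈ Finset.range n, (if P i then f (((Finset.Ico (i + 1) n).filter P).card)
        else g (i + ((Finset.Ico (i + 1) n).filter P).card)) =
      ∑ r ∈ Finset.range ((Finset.range n).filter P).card, f r +
        ∑ r ∈ Finset.Ico ((Finset.range n).filter P).card n, g r := by
  -- For `i` outside `P`, `i` plus the number of later elements of `P` equals the total number of
  -- elements of `P` plus the number of earlier indices outside `P`; this is why the `g`-sum starts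
  -- at that total.
  induction n generalizing f g with
  | zero => simp
  | succ n ih =>
    have hle : ((Finset.range n).filter P).card ≤ n := by
      simpa using Finset.card_filter_le (Finset.range n) P
    rw [Finset.sum_range_succ, Finset.range_add_one, Finset.filter_insert]
    by_cases hn : P n
    -- If `P n` holds, every earlier tail grows by one, so the induction hypothesis is needed for
    -- the shifts of `f` and `g`; the index `n` itself supplies `f 0`.
    · have hT : ∀ i ∈ Finset.range n, ((Finset.Ico (i + 1) (n + 1)).filter P).card =
          ((Finset.Ico (i + 1) n).filter P).card + 1 := by
        intro i hi
        have := Finset.mem_range.1 hi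
        rw [← Finset.insert_Ico_right_eq_Ico_add_one (by omega), Finset.filter_insert, if_pos hn,
          Finset.card_insert_of_notMem (by simp)]
      rw [Finset.sum_congr rfl fun i hi => by rw [hT i hi, ← add_assoc]]
      rw [ih (fun r => f (r + 1)) fun r => g (r + 1), if_pos hn, if_pos hn,
        Finset.card_insert_of_notMem (by simp), Finset.sum_range_succ', Finset.sum_Ico_add']
      simp only [Finset.Ico_self, Finset.filter_empty, Finset.card_empty]
      rw [add_right_comm]
    · have hT : ∀ i ∈ Finset.range n, ((Finset.Ico (i + 1) (n + 1)).filter P).card =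
          ((Finset.Ico (i + 1) n).filter P).card := by
        intro i hi
        have := Finset.mem_range.1 hi
        rw [← Finset.insert_Ico_right_eq_Ico_add_one (by omega), Finset.filter_insert, if_neg hn]
      rw [Finset.sum_congr rfl fun i hi => by rw [hT i hi]]
      rw [ih f g, if_neg hn, if_neg hn, Finset.sum_Ico_succ_top hle]
      simp [add_assoc]

/-! ### Signed permutations as words in one type for all `n` -/

/-- The word `0, π_1, …, π_n, 0, 0, …`. -/
noncomputable def word {n : ℕ} (π : Equiv.Perm (pmSet n)) (i : ℕ) : ℤ := letter π i

/-- The words of the signed permutations of `[n]`. -/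
structure IsSignedWord (n : ℕ) (w : ℕ → ℤ) : Prop where
  zero : w 0 = 0
  outside : ∀ i, n < i → w i = 0
  natAbs_mem : ∀ i ∈ Finset.Icc 1 n, (w i).natAbs ∈ Finset.Icc 1 n
  injOn : Set.InjOn (fun i => (w i).natAbs) (Finset.Icc 1 n)

lemma IsSignedWord.eq_of_natAbs_eq {n : ℕ} {w : ℕ → ℤ} (hw : IsSignedWord n w) (i : ℕ)
    (hi : 1 ≤ i ∧ i ≤ n) (j : ℕ) (hj : 1 ≤ j ∧ j ≤ n) (h : (w i).natAbs = (w j).natAbs) : i = j :=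
  hw.injOn (by simpa using hi) (by simpa using hj) h

lemma mem_pmSet {n : ℕ} {i : ℤ} : i ∈ pmSet n ↔ i.natAbs ∈ Finset.Icc 1 n := by
  simp only [pmSet, Finset.mem_erase, Finset.mem_Icc]
  omega

lemma natCast_mem_pmSet {n i : ℕ} : (i : ℤ) ∈ pmSet n ↔ i ∈ Finset.Icc 1 n := by
  rw [mem_pmSet, Int.natAbs_natCast]

lemma word_of_mem {n i : ℕ} (π : Equiv.Perm (pmSet n)) (hi : (i : ℤ) ∈ pmSet n) :
    word π i = π ⟨i, hi⟩ := dif_pos hi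

lemma word_of_notMem {n i : ℕ} (π : Equiv.Perm (pmSet n)) (hi : (i : ℤ) ∉ pmSet n) :
    word π i = 0 := dif_neg hi

lemma isSignedWord_word {n : ℕ} {π : Equiv.Perm (pmSet n)} (hπ : π ∈ signedPerms n) :
    IsSignedWord n (word π) where
  zero := word_of_notMem π (by simp [pmSet])
  outside i hi := word_of_notMem π (by simp [pmSet]; omega)
  natAbs_mem i hi := by
    rw [word_of_mem π (natCast_mem_pmSet.2 hi)]
    exact mem_pmSet.1 (π _).2
  injOn i hi j hj h := by
    have hi' := natCast_mem_pmSet.2 hi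
    have hj' := natCast_mem_pmSet.2 hj
    have hneg : -(j : ℤ) ∈ pmSet n := by
      rw [mem_pmSet] at hj' ⊢
      simpa using hj'
    have hπ' := (Finset.mem_filter.1 hπ).2 ⟨j, hj'⟩ ⟨-j, hneg⟩ rfl
    simp only [word_of_mem π hi', word_of_mem π hj'] at h
    rcases Int.natAbs_eq_natAbs_iff.1 h with h | h
    · simpa using π.injective (Subtype.ext h)
    -- Here `π_i = -π_j = π_{-j}` would force `i = -j`, impossible for positive `i` and `j`.
    · rw [← hπ'] at h
      have := congrArg Subtype.val (π.injective (Subtype.ext h))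
      simp only at this
      simp only [Finset.coe_Icc, Set.mem_Icc] at hi
      omega

lemma word_injOn (n : ℕ) : Set.InjOn (word (n := n)) (signedPerms n) := by
  intro π hπ σ hσ h
  ext ⟨i, hi⟩
  have hi' := mem_pmSet.1 hi
  have hnat : ((i.natAbs : ℕ) : ℤ) ∈ pmSet n := natCast_mem_pmSet.2 hi'
  have h' := congrFun h i.natAbs
  rw [word_of_mem π hnat, word_of_mem σ hnat] at h'
  rcases Int.natAbs_eq i with hpos | hneg
  · simpa [← hpos] using h'
  · rw [(Finset.mem_filter.1 hπ).2 ⟨_, hnat⟩ ⟨i, hi⟩ hneg,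
      (Finset.mem_filter.1 hσ).2 ⟨_, hnat⟩ ⟨i, hi⟩ hneg, h']

/-- The permutation is the odd extension `i ↦ sign(i) w_{|i|}`. -/
lemma IsSignedWord.exists_word_eq {n : ℕ} {w : ℕ → ℤ} (hw : IsSignedWord n w) :
    ∃ π ∈ signedPerms n, word π = w := by
  have habs : ∀ i : pmSet n, ((i : ℤ).sign * w (i : ℤ).natAbs).natAbs =
      (w (i : ℤ).natAbs).natAbs := by
    intro i
    have hi := mem_pmSet.1 i.2
    rw [Finset.mem_Icc] at hi
    rw [Int.natAbs_mul, Int.natAbs_sign_of_ne_zero (by omega), one_mul]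
  let f : pmSet n → pmSet n := fun i => ⟨(i : ℤ).sign * w (i : ℤ).natAbs, by
    rw [mem_pmSet, habs]
    exact hw.natAbs_mem _ (mem_pmSet.1 i.2)⟩
  have hf : Function.Injective f := by
    intro i j hij
    have hij : (i : ℤ).sign * w (i : ℤ).natAbs = (j : ℤ).sign * w (j : ℤ).natAbs :=
      congrArg Subtype.val hij
    have h1 : (i : ℤ).natAbs = (j : ℤ).natAbs := by
      apply hw.injOn (mem_pmSet.1 i.2) (mem_pmSet.1 j.2)
      simp only
      rw [← habs, ← habs, hij]
    have h2 := hw.natAbs_mem _ (mem_pmSet.1 j.2)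
    rw [Finset.mem_Icc] at h2
    rw [h1] at hij
    have h3 := mul_right_cancel₀ (by omega) hij
    apply Subtype.ext
    rw [← Int.sign_mul_natAbs (i : ℤ), ← Int.sign_mul_natAbs (j : ℤ), h1, h3]
  refine ⟨Equiv.ofBijective f (Finite.injective_iff_bijective.1 hf), ?_, ?_⟩
  · refine Finset.mem_filter.2 ⟨Finset.mem_univ _, fun i j hij => ?_⟩
    simp [f, hij, Int.sign_neg]
  · ext i
    by_cases hi : (i : ℤ) ∈ pmSet n
    · rw [word_of_mem _ hi]
      have := natCast_mem_pmSet.1 hi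
      rw [Finset.mem_Icc] at this
      simp [f, Int.sign_natCast_of_ne_zero (show i ≠ 0 by omega)]
    · rw [word_of_notMem _ hi]
      rw [natCast_mem_pmSet, Finset.mem_Icc] at hi
      rcases Nat.eq_zero_or_pos i with rfl | h
      · exact hw.zero.symm
      · exact (hw.outside i (by omega)).symm

/-- The finite set of words of signed permutations of `[n]`. -/
noncomputable def signedWords (n : ℕ) : Finset (ℕ → ℤ) :=
  letI := Classical.decEq (ℕ → ℤ)
  (signedPerms n).image word

lemma mem_signedWords {n : ℕ} {w : ℕ → ℤ} : w ∈ signedWords n ↔ IsSignedWord n w := by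
  classical
  simp only [signedWords, Finset.mem_image]
  constructor
  · rintro ⟨π, hπ, rfl⟩
    exact isSignedWord_word hπ
  · exact fun h => h.exists_word_eq

lemma sum_signedWords {M : Type*} [AddCommMonoid M] (n : ℕ) (F : (ℕ → ℤ) → M) :
    ∑ w ∈ signedWords n, F w = ∑ π ∈ signedPerms n, F (word π) := by
  classical
  exact Finset.sum_image (word_injOn n)

/-! ### Insertion and deletion of the letter of largest absolute value -/

/-- Insert the letter `c` after position `i`. -/
def insertLetter (w : ℕ → ℤ) (i : ℕ) (c : ℤ) (j : ℕ) : ℤ :=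
  if j ≤ i then w j else if j = i + 1 then c else w (j - 1)

/-- Delete the letter at position `i + 1`. -/
def deleteLetter (w : ℕ → ℤ) (i : ℕ) (j : ℕ) : ℤ :=
  if j ≤ i then w j else w (j + 1)

lemma insertLetter_of_le {w : ℕ → ℤ} {i j : ℕ} {c : ℤ} (h : j ≤ i) :
    insertLetter w i c j = w j := if_pos h

@[simp] lemma insertLetter_self (w : ℕ → ℤ) (i : ℕ) (c : ℤ) :
    insertLetter w i c (i + 1) = c := by simp [insertLetter]

lemma insertLetter_succ_of_lt {w : ℕ → ℤ} {i j : ℕ} {c : ℤ} (h : i < j) :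
    insertLetter w i c (j + 1) = w j := by
  rw [insertLetter, if_neg (by omega), if_neg (by omega), Nat.add_sub_cancel]

lemma deleteLetter_insertLetter (w : ℕ → ℤ) (i : ℕ) (c : ℤ) :
    deleteLetter (insertLetter w i c) i = w := by
  ext j
  rw [deleteLetter]
  split_ifs with h
  · exact insertLetter_of_le h
  · exact insertLetter_succ_of_lt (by omega)

lemma insertLetter_deleteLetter (w : ℕ → ℤ) (i : ℕ) :
    insertLetter (deleteLetter w i) i (w (i + 1)) = w := by
  ext j
  simp only [insertLetter, deleteLetter]
  split_ifs with h1 h2 h3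
  · rfl
  · rw [h2]
  · omega
  · congr 1
    omega

lemma IsSignedWord.insertLetter {n i : ℕ} {w : ℕ → ℤ} {c : ℤ} (hw : IsSignedWord n w)
    (hi : i ≤ n) (hc : c.natAbs = n + 1) : IsSignedWord (n + 1) (insertLetter w i c) where
  zero := by rw [insertLetter_of_le (Nat.zero_le _), hw.zero]
  outside j hj := by
    obtain ⟨j, rfl⟩ : ∃ m, j = m + 1 := ⟨j - 1, by omega⟩
    rw [insertLetter_succ_of_lt (by omega), hw.outside _ (by omega)]
  natAbs_mem j hj := by
    have hw' := fun j => hw.natAbs_mem j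
    simp only [Finset.mem_Icc] at hj hw' ⊢
    unfold FlagMajor.insertLetter
    split_ifs with h1 h2
    · have := hw' j (by omega); omega
    · omega
    · have := hw' (j - 1) (by omega); omega
  injOn j hj l hl h := by
    have hw' := fun j => hw.natAbs_mem j
    have hin := hw.eq_of_natAbs_eq
    simp only [Finset.coe_Icc, Set.mem_Icc, Finset.mem_Icc] at hj hl hw'
    simp only [FlagMajor.insertLetter] at h
    split_ifs at h with h1 h2 h3 h4 h5 h6 h7 h8
    · exact hin j (by omega) l (by omega) h
    · have := hw' j (by omega); omega
    · have := hin j (by omega) (l - 1) (by omega) h; omega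
    · have := hw' l (by omega); omega
    · omega
    · have := hw' (l - 1) (by omega); omega
    · have := hin (j - 1) (by omega) l (by omega) h; omega
    · have := hw' (j - 1) (by omega); omega
    · have := hin (j - 1) (by omega) (l - 1) (by omega) h; omega

lemma IsSignedWord.exists_natAbs_eq {n : ℕ} {w : ℕ → ℤ} (hw : IsSignedWord (n + 1) w) :
    ∃ i ≤ n, (w (i + 1)).natAbs = n + 1 := by
  obtain ⟨j, hj, h⟩ := Finset.surjOn_of_injOn_of_card_le (fun i => (w i).natAbs)
    (fun i hi => hw.natAbs_mem i hi) hw.injOn le_rfl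
    (Finset.mem_coe.2 (Finset.mem_Icc.2 ⟨Nat.le_add_left 1 n, le_rfl⟩))
  rw [Finset.mem_coe, Finset.mem_Icc] at hj
  obtain ⟨i, rfl⟩ : ∃ m, j = m + 1 := ⟨j - 1, by omega⟩
  exact ⟨i, by omega, h⟩

lemma IsSignedWord.deleteLetter {n i : ℕ} {w : ℕ → ℤ} (hw : IsSignedWord (n + 1) w)
    (hi : i ≤ n) (h : (w (i + 1)).natAbs = n + 1) : IsSignedWord n (deleteLetter w i) := by
  have hw' := fun j => hw.natAbs_mem j
  have hin := hw.eq_of_natAbs_eq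
  simp only [Finset.mem_Icc] at hw'
  have hne : ∀ j, 1 ≤ j → j ≤ n + 1 → j ≠ i + 1 → (w j).natAbs ≠ n + 1 := by
    intro j h1 h2 h3 h4
    exact h3 (hin j ⟨h1, h2⟩ (i + 1) ⟨by omega, by omega⟩ (h4.trans h.symm))
  refine ⟨?_, ?_, ?_, ?_⟩
  · rw [FlagMajor.deleteLetter, if_pos (Nat.zero_le _), hw.zero]
  · intro j hj
    rw [FlagMajor.deleteLetter, if_neg (by omega), hw.outside _ (by omega)]
  · intro j hj
    rw [Finset.mem_Icc] at hj ⊢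
    unfold FlagMajor.deleteLetter
    split_ifs with h1
    · have := hw' j (by omega)
      have := hne j (by omega) (by omega) (by omega)
      omega
    · have := hw' (j + 1) (by omega)
      have := hne (j + 1) (by omega) (by omega) (by omega)
      omega
  · intro j hj l hl hjl
    simp only [Finset.coe_Icc, Set.mem_Icc] at hj hl
    simp only [FlagMajor.deleteLetter] at hjl
    split_ifs at hjl with h1 h2
    · exact hin j (by omega) l (by omega) hjl
    · have := hin j (by omega) (l + 1) (by omega) hjl; omega
    · have := hin (j + 1) (by omega) l (by omega) hjl; omega
    · have := hin (j + 1) (by omega) (l + 1) (by omega) hjl; omega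

/-- The letter of absolute value `n + 1` occurs exactly once, so deleting it recovers the shorter
word, the gap and the sign. -/
lemma sum_signedWords_succ {M : Type*} [AddCommMonoid M] (n : ℕ) (F : (ℕ → ℤ) → M) :
    ∑ w ∈ signedWords (n + 1), F w = ∑ w ∈ signedWords n, ∑ i ∈ Finset.range (n + 1),
      (F (insertLetter w i (n + 1)) + F (insertLetter w i (-(n + 1)))) := by
  have hpair : ∀ (w : ℕ → ℤ) (i : ℕ),
      F (insertLetter w i (n + 1)) + F (insertLetter w i (-(n + 1))) =
        ∑ c ∈ ({(n : ℤ) + 1, -((n : ℤ) + 1)} : Finset ℤ), F (insertLetter w i c) :=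
    fun w i => (Finset.sum_pair (f := fun c => F (insertLetter w i c)) (by omega)).symm
  have hc : ∀ c : ℤ, c ∈ ({(n : ℤ) + 1, -((n : ℤ) + 1)} : Finset ℤ) ↔ c.natAbs = n + 1 := by
    intro c
    simp only [Finset.mem_insert, Finset.mem_singleton]
    omega
  simp only [hpair]
  simp only [← Finset.sum_product']
  symm
  refine Finset.sum_bij (fun x _ => insertLetter x.1 x.2.1 x.2.2) ?_ ?_ ?_ fun _ _ => rfl
  · rintro ⟨w, i, c⟩ hx
    simp only [Finset.mem_product, mem_signedWords, hc, Finset.mem_range] at hx ⊢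
    exact hx.1.insertLetter (by omega) hx.2.2
  · rintro ⟨w, i, c⟩ hx ⟨w', i', c'⟩ hx' h
    simp only [Finset.mem_product, mem_signedWords, hc, Finset.mem_range] at hx hx' h
    have hs := hx.1.insertLetter (Nat.le_of_lt_succ hx.2.1) hx.2.2
    have hii : i = i' := by
      have h1 : (insertLetter w i c (i + 1)).natAbs = n + 1 := by simpa using hx.2.2
      have h2 : (insertLetter w i c (i' + 1)).natAbs = n + 1 := by simpa [h] using hx'.2.2
      have := hs.eq_of_natAbs_eq (i + 1) (by omega) (i' + 1) (by omega)
        (h1.trans h2.symm)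
      omega
    subst hii
    have hcc : c = c' := by simpa using congrFun h (i + 1)
    subst hcc
    have hww := congrArg (deleteLetter · i) h
    simp only [deleteLetter_insertLetter] at hww
    rw [hww]
  · intro w hw
    rw [mem_signedWords] at hw
    obtain ⟨i, hi, h⟩ := hw.exists_natAbs_eq
    refine ⟨(deleteLetter w i, i, w (i + 1)), ?_, insertLetter_deleteLetter w i⟩
    simp only [Finset.mem_product, mem_signedWords, hc, Finset.mem_range]
    exact ⟨hw.deleteLetter hi h, by omega, h⟩

lemma IsSignedWord.natAbs_le {n : ℕ} {w : ℕ → ℤ} (hw : IsSignedWord n w) (i : ℕ) :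
    (w i).natAbs ≤ n := by
  rcases Nat.eq_zero_or_pos i with rfl | h
  · simp [hw.zero]
  · rcases le_or_gt i n with h' | h'
    · exact (Finset.mem_Icc.1 (hw.natAbs_mem i (Finset.mem_Icc.2 ⟨h, h'⟩))).2
    · simp [hw.outside i h']

/-! ### Descents and flag-major index under insertion -/

/-- The number of descents of the first `n + 1` letters of a word. -/
def wordDes (n : ℕ) (w : ℕ → ℤ) : ℕ := ((Finset.range n).filter fun i => w (i + 1) < w i).card

/-- The flag-major index of the first `n + 1` letters of a word. -/
def wordFmaj (n : ℕ) (w : ℕ → ℤ) : ℕ :=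
  ∑ i ∈ Finset.range n, ((if w (i + 1) < w i then 2 * i else 0) + if w (i + 1) < 0 then 1 else 0)

lemma card_desB {n : ℕ} (π : Equiv.Perm (pmSet n)) : (desB π).card = wordDes n (word π) := by
  simp [desB, wordDes, word]

lemma fmaj_eq_wordFmaj {n : ℕ} (π : Equiv.Perm (pmSet n)) : fmaj π = wordFmaj n (word π) := by
  rw [wordFmaj, Finset.sum_add_distrib, fmaj, neg, desB, Finset.sum_filter, Finset.card_filter,
    Finset.range_eq_Ico, Finset.sum_Ico_add' (fun i => if word π i < 0 then 1 else 0)]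
  simp only [word, Nat.cast_add, Nat.cast_one, zero_add]
  rfl

lemma wordDes_eq_sum (n : ℕ) (w : ℕ → ℤ) :
    wordDes n w = ∑ i ∈ Finset.range n, if w (i + 1) < w i then 1 else 0 :=
  Finset.card_filter _ _

lemma sum_range_split {i n : ℕ} (hi : i < n) (f : ℕ → ℕ) :
    ∑ j ∈ Finset.range n, f j =
      ∑ j ∈ Finset.range i, f j + f i + ∑ j ∈ Finset.Ico (i + 1) n, f j := by
  rw [← Finset.sum_range_succ, Finset.sum_range_add_sum_Ico _ hi]

lemma sum_insertLetter {i n : ℕ} (hi : i < n) (w : ℕ → ℤ) (c : ℤ) (φ : ℕ → ℤ → ℤ → ℕ) :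
    ∑ j ∈ Finset.range (n + 1), φ j (insertLetter w i c j) (insertLetter w i c (j + 1)) =
      ∑ j ∈ Finset.range i, φ j (w j) (w (j + 1)) + φ i (w i) c + φ (i + 1) c (w (i + 1)) +
        ∑ j ∈ Finset.Ico (i + 1) n, φ (j + 1) (w j) (w (j + 1)) := by
  rw [sum_range_split (show i + 1 < n + 1 by omega), Finset.sum_range_succ, insertLetter_self,
    insertLetter_of_le le_rfl, insertLetter_succ_of_lt (Nat.lt_succ_self i),
    ← Finset.sum_Ico_add' (fun j => φ j (insertLetter w i c j) (insertLetter w i c (j + 1)))]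
  congr 1
  · congr 2
    refine Finset.sum_congr rfl fun j hj => ?_
    rw [Finset.mem_range] at hj
    rw [insertLetter_of_le hj.le, insertLetter_of_le hj]
  · refine Finset.sum_congr rfl fun j hj => ?_
    rw [Finset.mem_Ico] at hj
    rw [insertLetter_succ_of_lt (by omega), insertLetter_succ_of_lt (by omega)]

lemma sum_insertLetter_last (n : ℕ) (w : ℕ → ℤ) (c : ℤ) (φ : ℕ → ℤ → ℤ → ℕ) :
    ∑ j ∈ Finset.range (n + 1), φ j (insertLetter w n c j) (insertLetter w n c (j + 1)) =
      ∑ j ∈ Finset.range n, φ j (w j) (w (j + 1)) + φ n (w n) c := by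
  rw [Finset.sum_range_succ, insertLetter_self, insertLetter_of_le le_rfl]
  congr 1
  refine Finset.sum_congr rfl fun j hj => ?_
  rw [Finset.mem_range] at hj
  rw [insertLetter_of_le hj.le, insertLetter_of_le hj]

/-- The number of descents of a word after position `i`. -/
def tailDes (n : ℕ) (w : ℕ → ℤ) (i : ℕ) : ℕ :=
  ((Finset.Ico (i + 1) n).filter fun j => w (j + 1) < w j).card

/-- The comparison across gap `i` is replaced by two comparisons with `c`. The lost one stands on
the left to avoid truncated subtraction. -/
lemma wordDes_insertLetter {i n : ℕ} (hi : i < n) (w : ℕ → ℤ) (c : ℤ) :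
    wordDes (n + 1) (insertLetter w i c) + (if w (i + 1) < w i then 1 else 0) =
      wordDes n w + (if c < w i then 1 else 0) + (if w (i + 1) < c then 1 else 0) := by
  rw [wordDes_eq_sum, wordDes_eq_sum, sum_insertLetter hi w c fun _ a b => if b < a then 1 else 0,
    sum_range_split hi]
  ring

/-- Each descent beyond the gap moves one place to the right and so contributes 2 more. -/
lemma wordFmaj_insertLetter {i n : ℕ} (hi : i < n) (w : ℕ → ℤ) (c : ℤ) :
    wordFmaj (n + 1) (insertLetter w i c) + (if w (i + 1) < w i then 2 * i else 0) =
      wordFmaj n w + (if c < w i then 2 * i else 0) + (if w (i + 1) < c then 2 * (i + 1) else 0) +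
        (if c < 0 then 1 else 0) + 2 * tailDes n w i := by
  have ht : ∑ j ∈ Finset.Ico (i + 1) n, ((if w (j + 1) < w j then 2 * (j + 1) else 0) +
        if w (j + 1) < 0 then 1 else 0) =
      ∑ j ∈ Finset.Ico (i + 1) n, ((if w (j + 1) < w j then 2 * j else 0) +
        if w (j + 1) < 0 then 1 else 0) + 2 * tailDes n w i := by
    rw [tailDes, Finset.card_filter, Finset.mul_sum, ← Finset.sum_add_distrib]
    refine Finset.sum_congr rfl fun j _ => ?_
    split_ifs <;> ring
  rw [wordFmaj, wordFmaj, sum_insertLetter hi w c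
    fun j a b => (if b < a then 2 * j else 0) + if b < 0 then 1 else 0, ht, sum_range_split hi]
  ring

lemma wordDes_insertLetter_last (n : ℕ) (w : ℕ → ℤ) (c : ℤ) :
    wordDes (n + 1) (insertLetter w n c) = wordDes n w + if c < w n then 1 else 0 := by
  rw [wordDes_eq_sum, wordDes_eq_sum,
    sum_insertLetter_last n w c fun _ a b => if b < a then 1 else 0]

lemma wordFmaj_insertLetter_last (n : ℕ) (w : ℕ → ℤ) (c : ℤ) :
    wordFmaj (n + 1) (insertLetter w n c) =
      wordFmaj n w + ((if c < w n then 2 * n else 0) + if c < 0 then 1 else 0) := by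
  rw [wordFmaj, wordFmaj, sum_insertLetter_last n w c
    fun j a b => (if b < a then 2 * j else 0) + if b < 0 then 1 else 0]

/-- The joint distribution of descents and flag-major index over all insertions of `±(n + 1)` into
a signed word: the `2n + 2` insertions raise the flag-major index by `0, 1, …, 2n + 1`, and the
first `2d + 1` of these are the ones that keep the number `d` of descents. -/
lemma sum_insertLetter_des_fmaj {M : Type*} [AddCommMonoid M] {n : ℕ} {w : ℕ → ℤ}
    (hw : IsSignedWord n w) (G : ℕ → ℕ → M) :
    ∑ i ∈ Finset.range (n + 1),
      (G (wordDes (n + 1) (insertLetter w i (n + 1))) (wordFmaj (n + 1) (insertLetter w i (n + 1))) +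
        G (wordDes (n + 1) (insertLetter w i (-(n + 1))))
          (wordFmaj (n + 1) (insertLetter w i (-(n + 1))))) =
      ∑ r ∈ Finset.range (wordDes n w), (G (wordDes n w) (wordFmaj n w + (2 * r + 2)) +
          G (wordDes n w) (wordFmaj n w + (2 * r + 1))) +
        ∑ r ∈ Finset.Ico (wordDes n w) n, (G (wordDes n w + 1) (wordFmaj n w + (2 * r + 2)) +
          G (wordDes n w + 1) (wordFmaj n w + (2 * r + 1))) +
        (G (wordDes n w) (wordFmaj n w) + G (wordDes n w + 1) (wordFmaj n w + (2 * n + 1))) := by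
  rw [Finset.sum_range_succ]
  have hlt : ∀ j, w j < n + 1 := fun j => by have := hw.natAbs_le j; omega
  have hgt : ∀ j, -((n : ℤ) + 1) < w j := fun j => by have := hw.natAbs_le j; omega
  have hlt' : ∀ j, ¬ ((n : ℤ) + 1 < w j) := fun j => (hlt j).not_gt
  have hgt' : ∀ j, ¬ (w j < -((n : ℤ) + 1)) := fun j => (hgt j).not_gt
  have hpos : ¬ ((n : ℤ) + 1 < 0) := by omega
  have hneg : -((n : ℤ) + 1) < 0 := by omega
  congr 1
  · rw [wordDes, ← sum_range_ite_tail (fun i => w (i + 1) < w i) n, ← wordDes]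
    refine Finset.sum_congr rfl fun i hi => ?_
    have hi := Finset.mem_range.1 hi
    rw [← tailDes]
    have d1 := wordDes_insertLetter hi w (n + 1)
    have d2 := wordDes_insertLetter hi w (-(n + 1))
    have f1 := wordFmaj_insertLetter hi w (n + 1)
    have f2 := wordFmaj_insertLetter hi w (-(n + 1))
    rw [if_neg (hlt' _), if_pos (hlt _)] at d1 f1
    rw [if_pos (hgt _), if_neg (hgt' _)] at d2 f2
    rw [if_neg hpos] at f1
    rw [if_pos hneg] at f2
    -- With `t` later descents, the letters `n + 1` and `-(n + 1)` raise `fmaj` by `2t + 2` and `2t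
    -- + 1` in a descent gap, and by `2(i + t) + 2` and `2(i + t) + 1` in an ascent gap, where a
    -- descent is gained.
    split_ifs at d1 d2 f1 f2 ⊢ with h
    · congr 2 <;> omega
    · congr 2 <;> omega
  · rw [wordDes_insertLetter_last, wordDes_insertLetter_last, wordFmaj_insertLetter_last,
      wordFmaj_insertLetter_last, if_neg (hlt' _), if_pos (hgt _), if_neg hpos, if_pos hneg,
      if_neg (hlt' _), if_pos (hgt _)]
    rfl

/-! ### Telescoping of `q`-integers and the recurrence -/

lemma T_one_sub_one_ne_zero : (T 1 - 1 : ℤ[T;T⁻¹]) ≠ 0 := by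
  intro h
  have := degree_T (R := ℤ) 1
  rw [sub_eq_zero.1 h, ← T_zero, degree_T] at this
  simp at this

lemma T_one_sub_one_mul_sum_Ico {a b : ℤ} (h : a ≤ b) :
    (T 1 - 1) * ∑ i ∈ Finset.Ico a b, T i = (T b - T a : ℤ[T;T⁻¹]) := by
  induction b, h using Int.leInduction with
  | base => simp
  | succ b hb ih =>
    rw [← Finset.insert_Ico_right_eq_Ico_add_one hb, Finset.sum_insert (by simp), mul_add, ih,
      sub_mul, ← T_add, one_mul, add_comm 1 b]
    ring

lemma T_one_sub_one_mul_qInt (m : ℤ) : (T 1 - 1) * qInt m = T m - 1 := by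
  rw [qInt, mul_sub]
  rcases le_total 0 m with h | h
  · rw [Finset.Ico_eq_empty (by omega : ¬ m < 0), T_one_sub_one_mul_sum_Ico h]
    simp
  · rw [Finset.Ico_eq_empty (by omega : ¬ 0 < m), T_one_sub_one_mul_sum_Ico h]
    simp

lemma sum_pairs_Ico (a b : ℕ) (h : a ≤ b) :
    (T 1 - 1) * ∑ r ∈ Finset.Ico a b, (T (2 * (r : ℤ) + 2) + T (2 * (r : ℤ) + 1)) =
      (T (2 * (b : ℤ) + 1) - T (2 * (a : ℤ) + 1) : ℤ[T;T⁻¹]) := by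
  induction b, h using Nat.le_induction with
  | base => simp
  | succ b hb ih =>
    rw [Finset.sum_Ico_succ_top hb, mul_add, ih]
    simp only [sub_mul, mul_add, ← T_add, one_mul]
    push_cast
    ring_nf

lemma wordDes_le (n : ℕ) (w : ℕ → ℤ) : wordDes n w ≤ n := by
  simpa [wordDes] using Finset.card_filter_le (Finset.range n) fun i => w (i + 1) < w i

lemma Bfmaj_natCast_eq_sum_signedWords (n k : ℕ) :
    Bfmaj n k = ∑ w ∈ signedWords n, T (wordFmaj n w) * starWeight (wordDes n w) k := by
  rw [Bfmaj_natCast, sum_signedWords n fun w => T (wordFmaj n w) * starWeight (wordDes n w) k]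
  simp only [card_desB, fmaj_eq_wordFmaj]

/-- The increments `0, …, 2d` carry `starWeight d k` and `2d+1, …, 2n+1` carry `starWeight (d + 1)
k`; each block telescopes. -/
lemma sum_insertLetter_starWeight {n : ℕ} {w : ℕ → ℤ} (hw : IsSignedWord n w) (k : ℕ) :
    (T 1 - 1) * ∑ i ∈ Finset.range (n + 1),
      (T (wordFmaj (n + 1) (insertLetter w i (n + 1))) *
          starWeight (wordDes (n + 1) (insertLetter w i (n + 1))) k +
        T (wordFmaj (n + 1) (insertLetter w i (-(n + 1)))) *
          starWeight (wordDes (n + 1) (insertLetter w i (-(n + 1)))) k) =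
      T (wordFmaj n w) * ((T (2 * (wordDes n w : ℤ) + 1) - 1) * starWeight (wordDes n w) k +
        (T (2 * (n : ℤ) + 2) - T (2 * (wordDes n w : ℤ) + 1)) *
          starWeight (wordDes n w + 1) k) := by
  rw [sum_insertLetter_des_fmaj hw fun d m => T (m : ℤ) * starWeight d k]
  have hle := wordDes_le n w
  generalize wordDes n w = d at *
  generalize wordFmaj n w = m
  have h1 := sum_pairs_Ico 0 d (Nat.zero_le d)
  have h2 := sum_pairs_Ico d n hle
  rw [← Finset.range_eq_Ico] at h1
  have e : ∀ (s : Finset ℕ) (c : ℤ[T;T⁻¹]),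
      ∑ r ∈ s, (T ((m + (2 * r + 2) : ℕ) : ℤ) * c + T ((m + (2 * r + 1) : ℕ) : ℤ) * c) =
        T (m : ℤ) * c * ∑ r ∈ s, (T (2 * (r : ℤ) + 2) + T (2 * (r : ℤ) + 1)) := by
    intro s c
    rw [Finset.mul_sum]
    refine Finset.sum_congr rfl fun r _ => ?_
    push_cast
    rw [T_add, T_add (m : ℤ) (2 * (r : ℤ) + 1)]
    ring
  rw [e, e]
  have h3 : (T ((m + (2 * n + 1) : ℕ) : ℤ) : ℤ[T;T⁻¹]) = T (m : ℤ) * T (2 * (n : ℤ) + 1) := by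
    rw [← T_add]; push_cast; rfl
  have h4 : (T (2 * (n : ℤ) + 2) : ℤ[T;T⁻¹]) = T 1 * T (2 * (n : ℤ) + 1) := by
    rw [← T_add]; ring_nf
  have h5 : (T (2 * ((0 : ℕ) : ℤ) + 1) : ℤ[T;T⁻¹]) = T 1 := by simp
  rw [h5] at h1
  rw [h3, h4]
  linear_combination T (m : ℤ) * starWeight d k * h1 + T (m : ℤ) * starWeight (d + 1) k * h2

/-- Expanding `starWeight (d + 1) (k + 1)` cancels `q^{2d+1}` in the coefficient of `starWeight d (k
+ 1)`. The rest is `q^{2n+2}` times `starWeight_succ_right`. -/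
lemma starWeight_insertion_identity (n d k : ℕ) :
    (T (2 * (d : ℤ) + 1) - 1) * starWeight d (k + 1) +
        (T (2 * (n : ℤ) + 2) - T (2 * (d : ℤ) + 1)) * starWeight (d + 1) (k + 1) =
      (T (2 * (n : ℤ) - 2 * k) - 1) * starWeight d (k + 1) +
        (T (2 * (n : ℤ) - 2 * k + 1) - 1) * starWeight d k := by
  have h := congrArg (T (2 * (n : ℤ) + 2) * ·) (starWeight_succ_right d k)
  rw [starWeight_succ_succ]
  simp only [← mul_assoc, mul_sub, sub_mul, mul_add, ← T_add, one_mul] at h ⊢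
  ring_nf at h ⊢
  simp only [T_zero] at h ⊢
  linear_combination h

lemma Bfmaj_succ_zero (n : ℕ) : Bfmaj (n + 1) 0 = qInt (2 * (n : ℤ) + 2) * Bfmaj n 0 := by
  apply mul_left_cancel₀ T_one_sub_one_ne_zero
  have h0 := Bfmaj_natCast_eq_sum_signedWords n 0
  have h1 := Bfmaj_natCast_eq_sum_signedWords (n + 1) 0
  rw [Nat.cast_zero] at h0 h1
  rw [← mul_assoc, T_one_sub_one_mul_qInt, h0, h1, sum_signedWords_succ, Finset.mul_sum,
    Finset.mul_sum]
  refine Finset.sum_congr rfl fun w hw => ?_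
  rw [sum_insertLetter_starWeight (mem_signedWords.1 hw)]
  simp only [starWeight_zero_right]
  ring

lemma Bfmaj_succ_succ (n k : ℕ) : Bfmaj (n + 1) ((k + 1 : ℕ) : ℤ) =
    qInt (2 * (n : ℤ) - 2 * k) * Bfmaj n ((k + 1 : ℕ) : ℤ) +
      qInt (2 * (n : ℤ) - 2 * k + 1) * Bfmaj n k := by
  apply mul_left_cancel₀ T_one_sub_one_ne_zero
  rw [mul_add, ← mul_assoc, T_one_sub_one_mul_qInt, ← mul_assoc, T_one_sub_one_mul_qInt]
  simp only [Bfmaj_natCast_eq_sum_signedWords]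
  rw [sum_signedWords_succ, Finset.mul_sum, Finset.mul_sum, Finset.mul_sum,
    ← Finset.sum_add_distrib]
  refine Finset.sum_congr rfl fun w hw => ?_
  rw [sum_insertLetter_starWeight (mem_signedWords.1 hw), starWeight_insertion_identity]
  ring

lemma Bfmaj_recurrence (n : ℕ) (k : ℤ) :
    Bfmaj (n + 1) k = qInt (2 * ((n + 1 : ℕ) : ℤ) - 2 * k) * Bfmaj n k +
      qInt (2 * ((n + 1 : ℕ) : ℤ) - 2 * k + 1) * Bfmaj n (k - 1) := by
  rcases lt_or_ge k 0 with hk | hk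
  · simp [Bfmaj_eq_zero (n := n + 1) (Or.inl hk), Bfmaj_eq_zero (n := n) (Or.inl hk),
      Bfmaj_eq_zero (n := n) (k := k - 1) (Or.inl (by omega))]
  · lift k to ℕ using hk
    cases k with
    | zero =>
      rw [Nat.cast_zero, Bfmaj_succ_zero, Bfmaj_eq_zero (n := n) (k := 0 - 1) (Or.inl (by omega))]
      push_cast
      ring_nf
    | succ k =>
      rw [Bfmaj_succ_succ]
      push_cast
      ring_nf

/-! ### Boundary values and polynomiality -/

lemma Bfmaj_zero_zero : Bfmaj 0 0 = 1 := by
  have h := Bfmaj_natCast_eq_sum_signedWords 0 0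
  have hw : signedWords 0 = {0} := by
    ext w
    rw [mem_signedWords, Finset.mem_singleton]
    constructor
    · intro h
      ext i
      have := h.natAbs_le i
      simpa using this
    · rintro rfl
      exact ⟨rfl, fun _ _ => rfl, by simp, by simp⟩
  rw [hw] at h
  simpa [wordFmaj] using h

/-- On the diagonal the first term of the recurrence vanishes and the second has coefficient `[1]_q
= 1`. -/
lemma Bfmaj_self (n : ℕ) : Bfmaj n n = 1 := by
  induction n with
  | zero => exact Bfmaj_zero_zero
  | succ n ih =>
    rw [Bfmaj_recurrence, Bfmaj_eq_zero (n := n) (Or.inr (by push_cast; omega)), mul_zero, zero_add,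
      Nat.cast_succ, add_sub_cancel_right, ih, sub_self]
    simp [qInt, show Finset.Ico (0 : ℤ) 1 = {0} from rfl]

lemma qInt_mem_range_toLaurent {m : ℤ} (hm : 0 ≤ m) :
    qInt m ∈ (Polynomial.toLaurent (R := ℤ)).range := by
  rw [qInt, Finset.Ico_eq_empty (by omega : ¬ m < 0), Finset.sum_empty, sub_zero]
  refine sum_mem fun i hi => ?_
  rw [Finset.mem_Ico] at hi
  refine ⟨Polynomial.X ^ i.toNat, ?_⟩
  rw [Polynomial.toLaurent_X_pow, Int.toNat_of_nonneg hi.1]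

lemma Bfmaj_mem_range_toLaurent (n : ℕ) (k : ℤ) :
    Bfmaj n k ∈ (Polynomial.toLaurent (R := ℤ)).range := by
  induction n generalizing k with
  | zero =>
    rcases eq_or_ne k 0 with rfl | hk
    · rw [Bfmaj_zero_zero]
      exact one_mem _
    · rw [Bfmaj_eq_zero (by push_cast; omega)]
      exact zero_mem _
  | succ n ih =>
    -- A `q`-integer of negative index is not a polynomial; for `k ≤ n + 1` both indices in the
    -- recurrence are nonnegative.
    rcases lt_or_ge ((n + 1 : ℕ) : ℤ) k with hk | hk
    · rw [Bfmaj_eq_zero (Or.inr hk)]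
      exact zero_mem _
    · rw [Bfmaj_recurrence]
      exact add_mem (mul_mem (qInt_mem_range_toLaurent (by omega)) (ih _))
        (mul_mem (qInt_mem_range_toLaurent (by omega)) (ih _))

end FlagMajor

theorem proposition2p7 :
    (∀ (n : ℕ) (k : ℤ), 1 ≤ n →
      FlagMajor.Bfmaj n k =
        FlagMajor.qInt (2 * (n : ℤ) - 2 * k) * FlagMajor.Bfmaj (n - 1) k +
        FlagMajor.qInt (2 * (n : ℤ) - 2 * k + 1) * FlagMajor.Bfmaj (n - 1) (k - 1)) ∧
    (∀ n : ℕ, FlagMajor.Bfmaj n (n : ℤ) = 1) ∧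
    (∀ (n : ℕ) (k : ℤ), k < 0 ∨ (n : ℤ) < k → FlagMajor.Bfmaj n k = 0) ∧
    (∀ (n : ℕ) (k : ℤ), ∃ P : Polynomial ℤ, Polynomial.toLaurent P = FlagMajor.Bfmaj n k) := by
  refine ⟨fun n k hn => ?_, FlagMajor.Bfmaj_self, fun _ _ => FlagMajor.Bfmaj_eq_zero,
    FlagMajor.Bfmaj_mem_range_toLaurent⟩
  obtain ⟨n, rfl⟩ := Nat.exists_eq_add_of_le' hn
  exact FlagMajor.Bfmaj_recurrence n k
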